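/- Call a division ring $D$ centrally finite if it is a finite-dimensional vector space over its center, and weakly locally finite if, for every finite subset $S$ of $D$, the division subring of $D$ generated by $S$ is centrally finite. Let $D$ be a weakly locally finite division ring with center $F$ and multiplicative group $D^*$. Then every finitely generated subnormal subgroup $N$ of $D^*$ is central, i.e. $N\subseteq F$. -/

import Mathlib

/-- A division ring is centrally finite if it is finite-dimensional as a vector space over its
center. -/
def IsCentrallyFinite (D : Type*) [DivisionRing D] : Prop :=
  FiniteDimensional (Subring.center D) D

/-- A division ring `D` is weakly locally finite if, for every finite subset `S` of `D`, the
division subring of `D` generated by `S` is centrally finite (that is, finite-dimensional over its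
own center). Mathlib's `Subfield D`, for a division ring `D`, is the type of division subrings
of `D`; commutativity is not required. -/
def IsWeaklyLocallyFinite (D : Type*) [DivisionRing D] : Prop :=
  ∀ S : Set D, S.Finite → IsCentrallyFinite (Subfield.closure S)

/-! Adjoining one further element to the generators of `N` gives a division ring finite-dimensional
over its center `F`. If `x ∈ N` did not commute with some `a`, then `N`, `a` and the inverse of `x *
a - a * x` would lie in an order Λ over a finitely generated subring `R` of `F`. Subnormality puts
all late iterated conjugates of `x` by any `y` into `N`, hence into Λ; a `y` is built for which they
all leave Λ (`IsIntegralBasis.exists_iterConj_notMem_order`).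

For `m` maximal in `R`, the ring Λ/m³Λ is finite and the commutator is a unit in it, so `x` is
non-scalar in some matrix quotient. This yields `E` in Λ with `E * E` in m³Λ whose image is nonzero,
and with `E * x * E` reducing to a nonzero multiple of `E` (`exists_sq_zero_of_isUnit_commutator`).
Over a valuation ring dominating `R` at `m`, `E * E = t ^ 3 • ε`, so `y = t + E` has inverse `(t -
E) * (1 - t • ε)⁻¹` up to `t ^ 2`. Each conjugate, times a positive power of `t`, reduces to a
nonzero multiple of `E`, so it has a pole (`iterConj_notMem_order`). -/

/-! ### Finite quotients of finitely generated commutative rings -/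

theorem Int.isJacobsonRing : IsJacobsonRing ℤ := by
  rw [isJacobsonRing_iff_prime_eq]
  intro P hP
  by_cases h : P = ⊥
  · subst h
    refine le_antisymm (fun n hn => ?_) Ideal.le_jacobson
    by_contra hn0
    replace hn0 : n ≠ 0 := hn0
    rw [Ideal.mem_jacobson_bot] at hn
    -- `3 * n + 1 = ±1` forces `n = 0`; a factor 2 would still allow `n = -1`.
    have h1 := Int.isUnit_iff.1 (hn 3)
    omega
  · exact Ideal.jacobson_eq_self_of_isMaximal (H := hP.isMaximal h)

theorem finite_of_field_of_finiteType_int (K : Type*) [Field K] [Algebra.FiniteType ℤ K] :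
    Finite K := by
  have := Int.isJacobsonRing
  have hfin : Module.Finite ℤ K := finite_of_finite_type_of_isJacobsonRing ℤ K
  obtain ⟨p, hp⟩ := CharP.exists K
  rcases CharP.char_is_prime_or_zero K p with hprime | rfl
  · have := Fact.mk hprime
    let : Algebra (ZMod p) K := ZMod.algebra K p
    have : Module.Finite (ZMod p) K := Module.Finite.of_restrictScalars_finite ℤ (ZMod p) K
    exact Module.finite_of_finite (ZMod p)
  · exfalso
    have := CharP.charP_to_charZero K
    have hint : Algebra.IsIntegral ℤ K := inferInstance
    have := isField_of_isIntegral_of_isField (R := ℤ) (S := K)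
      (RingHom.injective_int (algebraMap ℤ K)) (Field.toIsField K)
    exact Int.not_isField this

theorem finite_quotient_pow_of_finiteType_int {R : Type*} [CommRing R] [Algebra.FiniteType ℤ R]
    (m : Ideal R) [m.IsMaximal] (n : ℕ) : Finite (R ⧸ m ^ n) := by
  have : Algebra.FiniteType ℤ (R ⧸ m) :=
    Algebra.FiniteType.of_surjective (Ideal.Quotient.mk m).toIntAlgHom
      Ideal.Quotient.mk_surjective
  have : Finite (R ⧸ m) := @finite_of_field_of_finiteType_int _ (Ideal.Quotient.field m) this
  have : IsNoetherianRing R := Algebra.FiniteType.isNoetherianRing ℤ R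
  exact Ideal.finite_quotient_pow (IsNoetherian.noetherian m) n

/-! ### Iterated conjugates and subnormality -/

/-- The sequence `y, y x y⁻¹, (y x y⁻¹) x (y x y⁻¹)⁻¹, …` of iterated conjugates. -/
def iterConj {G : Type*} [Group G] (x y : G) : ℕ → G
  | 0 => y
  | n + 1 => iterConj x y n * x * (iterConj x y n)⁻¹

/-- Conjugating `x ∈ H` by an element of `K`, with `H` normal in `K`, lands in `H`: each iteration
descends one level of the subnormal chain. -/
theorem Subgroup.IsSubnormal.exists_iterConj_mem {G : Type*} [Group G] {N : Subgroup G}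
    (hN : N.IsSubnormal) : ∃ n, ∀ x ∈ N, ∀ y, ∀ k ≥ n, iterConj x y k ∈ N := by
  induction hN with
  | top => exact ⟨0, fun _ _ _ _ _ => trivial⟩
  | step H K hle _ hn ih =>
    obtain ⟨n, hK⟩ := ih
    refine ⟨n + 1, fun x hx y k hk => ?_⟩
    obtain ⟨k, rfl⟩ : ∃ j, k = j + 1 := ⟨k - 1, by omega⟩
    have h1 := hK x (hle hx) y k (by omega)
    exact hn.conj_mem ⟨x, hle hx⟩ hx ⟨_, h1⟩

/-! ### Square-zero elements in finite rings -/

/-- The annihilator of `w` is not the union of two proper subspaces. -/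
theorem Module.Dual.exists_apply_eq_zero_of_notMem_span {K V : Type*} [Field K] [AddCommGroup V]
    [Module K V] {u v w : V} (hu : u ∉ Submodule.span K {w}) (hv : v ∉ Submodule.span K {w}) :
    ∃ f : V →ₗ[K] K, f w = 0 ∧ f u ≠ 0 ∧ f v ≠ 0 := by
  obtain ⟨f, hfu, hf⟩ := Submodule.exists_le_ker_of_notMem hu
  obtain ⟨g, hgv, hg⟩ := Submodule.exists_le_ker_of_notMem hv
  have hfw : f w = 0 := hf (Submodule.mem_span_singleton_self w)
  have hgw : g w = 0 := hg (Submodule.mem_span_singleton_self w)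
  by_cases hfv : f v = 0
  · by_cases hgu : g u = 0
    · exact ⟨f + g, by simp [*], by simpa [hgu] using hfu, by simpa [hfv] using hgv⟩
    · exact ⟨g, hgw, hgu, hgv⟩
  · exact ⟨f, hfw, hfu, hfv⟩

theorem Module.End.exists_sq_zero_of_not_commute {K V : Type*} [Field K] [AddCommGroup V]
    [Module K V] {x x' y : Module.End K V} (hx : x * x' = 1) (hx' : x' * x = 1)
    (hxy : x * y ≠ y * x) :
    ∃ (e E : Module.End K V) (α β : K), e * e = e ∧ e * E = E ∧ E * e = 0 ∧ E ≠ 0 ∧ α ≠ 0 ∧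
      β ≠ 0 ∧ E * x * E = α • E ∧ E * x' * E = β • E := by
  have h1 : ∀ v, x (x' v) = v := fun v => LinearMap.congr_fun hx v
  have h2 : ∀ v, x' (x v) = v := fun v => LinearMap.congr_fun hx' v
  obtain ⟨w, hw⟩ : ∃ w, LinearIndependent K ![w, x w] := by
    by_contra! h
    obtain ⟨a, rfl⟩ := LinearMap.exists_eq_smul_id_of_forall_notLinearIndependent h
    exact hxy (by ext; simp)
  rw [LinearIndependent.pair_iff] at hw
  have hw0 : w ≠ 0 := by
    rintro rfl
    simpa using hw 1 0 (by simp)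
  have hu : x w ∉ Submodule.span K {w} := by
    rw [Submodule.mem_span_singleton]
    rintro ⟨c, hc⟩
    simpa using hw c (-1) (by simp [hc])
  have hv : x' w ∉ Submodule.span K {w} := by
    rw [Submodule.mem_span_singleton]
    rintro ⟨c, hc⟩
    have := congrArg x hc
    rw [h1, map_smul] at this
    simpa using hw (-1) c (by simp [this])
  obtain ⟨f, hfw, hfu, hfv⟩ := Module.Dual.exists_apply_eq_zero_of_notMem_span hu hv
  obtain ⟨g, hg⟩ := Module.Projective.exists_dual_ne_zero K hw0
  -- `E` is the rank-one map `v ↦ f v • w`, so `E * z * E = f (z w) • E` for every `z`; `e` projects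
  -- onto the line of `w`.
  refine ⟨((g w)⁻¹ • g).smulRight w, f.smulRight w, f (x w), f (x' w), ?_, ?_, ?_, ?_, hfu, hfv,
    ?_, ?_⟩
  · ext v; simp [hg]
  · ext v; simp [hg]
  · ext v; simp [hfw]
  · intro h
    have := LinearMap.congr_fun h (x w)
    simp [hfu, hw0] at this
  · ext v; simp [smul_smul, mul_comm]
  · ext v; simp [smul_smul, mul_comm]

theorem Matrix.exists_sq_zero_of_not_commute {K : Type*} [Field K] {r : ℕ}
    {x x' y : Matrix (Fin r) (Fin r) K} (hx : x * x' = 1) (hx' : x' * x = 1)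
    (hxy : x * y ≠ y * x) :
    ∃ (e E : Matrix (Fin r) (Fin r) K) (α β : K), e * e = e ∧ e * E = E ∧ E * e = 0 ∧ E ≠ 0 ∧
      α ≠ 0 ∧ β ≠ 0 ∧ E * x * E = α • E ∧ E * x' * E = β • E := by
  let T := Matrix.toLinAlgEquiv' (R := K) (n := Fin r)
  obtain ⟨e, E, α, β, h1, h2, h3, h4, h5, h6, h7, h8⟩ :=
    Module.End.exists_sq_zero_of_not_commute (x := T x) (x' := T x') (y := T y)
      (by rw [← map_mul, hx, map_one]) (by rw [← map_mul, hx', map_one])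
      (by rw [← map_mul, ← map_mul]; exact fun h => hxy (T.injective h))
  have hT : ∀ z, T (T.symm z) = z := T.apply_symm_apply
  refine ⟨T.symm e, T.symm E, α, β, ?_, ?_, ?_, ?_, h5, h6, ?_, ?_⟩
  · rw [← map_mul, h1]
  · rw [← map_mul, h2]
  · rw [← map_mul, h3, map_zero]
  · exact fun h => h4 (by simpa using h)
  · apply T.injective; rw [map_mul, map_mul, map_smul, hT, h7]
  · apply T.injective; rw [map_mul, map_mul, map_smul, hT, h8]

universe u in
theorem exists_matrix_hom_of_finite {S : Type u} [Ring S] [Finite S] [Nontrivial S]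
    [IsSemisimpleRing S] {c : S} (hc : IsUnit c) :
    ∃ (K : Type u) (_ : Field K) (_ : Finite K) (r : ℕ)
      (φ : S →+* Matrix (Fin r) (Fin r) K) (σ : Matrix (Fin r) (Fin r) K → S),
      φ c ≠ 0 ∧ (∀ M, φ (σ M) = M) ∧ ∀ M M', σ M * σ M' = σ (M * M') := by
  classical
  obtain ⟨n, D, d, _, hd, ⟨e⟩⟩ := IsSemisimpleRing.exists_ringEquiv_pi_matrix_divisionRing S
  obtain ⟨i⟩ : Nonempty (Fin n) := by
    by_contra h
    rw [not_nonempty_iff] at h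
    exact not_subsingleton S e.toEquiv.subsingleton
  let φ : S →+* Matrix (Fin (d i)) (Fin (d i)) (D i) :=
    (Pi.evalRingHom (fun i => Matrix (Fin (d i)) (Fin (d i)) (D i)) i).comp e.toRingHom
  have hφ : Function.Surjective φ := (Function.surjective_eval i).comp e.surjective
  have : Finite (Matrix (Fin (d i)) (Fin (d i)) (D i)) := Finite.of_surjective φ hφ
  have := hd i
  have : Finite (D i) := Finite.of_injective
    (fun a : D i => Matrix.scalar (Fin (d i)) a) fun a b h => by simpa using h
  refine ⟨D i, littleWedderburn (D i), this, d i, φ, fun M => e.symm (Pi.single i M), ?_, ?_, ?_⟩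
  · exact (hc.map φ).ne_zero
  · intro M
    simp [φ]
  · intro M M'
    rw [← map_mul, ← Pi.single_mul]

-- The radical is nilpotent, so `e` lifts to an idempotent `f`. For any lift `b` of `E`, the corner
-- element `f * b * (1 - f)` still lifts `E` and has square exactly zero.
universe u in
theorem exists_sq_zero_of_isUnit_commutator {A : Type u} [Ring A] [Finite A] [Nontrivial A]
    {x x' a : A} (hx : x * x' = 1) (hx' : x' * x = 1) (hc : IsUnit (x * a - a * x)) :
    ∃ (K : Type u) (_ : Field K) (_ : Finite K) (r : ℕ)
      (φ : A →+* Matrix (Fin r) (Fin r) K) (E : A) (α β : K), Function.Surjective φ ∧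
      E * E = 0 ∧ φ E ≠ 0 ∧ α ≠ 0 ∧ β ≠ 0 ∧ φ E * φ x * φ E = α • φ E ∧
      φ E * φ x' * φ E = β • φ E := by
  let q := Ideal.Quotient.mk (Ring.jacobson A)
  have hq : Function.Surjective q := Ideal.Quotient.mk_surjective
  have : Finite (A ⧸ Ring.jacobson A) := Finite.of_surjective q hq
  have : Nontrivial (A ⧸ Ring.jacobson A) :=
    Ideal.Quotient.nontrivial_iff.2 (Ring.jacobson_lt_top A).ne
  obtain ⟨K, _, hK, r, φ, σ, hφc, hφσ, hσ⟩ := exists_matrix_hom_of_finite (hc.map q)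
  have hxa : φ (q x) * φ (q a) ≠ φ (q a) * φ (q x) := by
    intro h
    apply hφc
    simp only [map_sub, map_mul, h, sub_self]
  obtain ⟨e, E, α, β, h1, h2, h3, h4, h5, h6, h7, h8⟩ :=
    Matrix.exists_sq_zero_of_not_commute (x := φ (q x)) (x' := φ (q x'))
      (by simp only [← map_mul, hx, map_one]) (by simp only [← map_mul, hx', map_one]) hxa
  have hnil : ∀ z ∈ RingHom.ker q, IsNilpotent z := by
    intro z hz
    obtain ⟨n, hn⟩ := IsSemiprimaryRing.isNilpotent (R := A)
    rw [Ideal.mk_ker] at hz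
    refine ⟨n, ?_⟩
    have := Ideal.pow_mem_pow hz n
    rwa [hn] at this
  obtain ⟨f, hf, hfe⟩ := exists_isIdempotentElem_eq_of_ker_isNilpotent q hnil (σ e)
    (hq (σ e)) (by rw [IsIdempotentElem, hσ, h1])
  obtain ⟨b, hb⟩ := hq (σ E)
  have hE : φ (q (f * b * (1 - f))) = E := by
    simp only [map_mul, map_sub, hfe, hb, hφσ, h2, mul_sub, h3, mul_one, sub_zero]
  refine ⟨K, _, hK, r, φ.comp q, f * b * (1 - f), α, β, ?_, ?_, ?_, h5, h6, ?_, ?_⟩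
  · have hφ : Function.Surjective φ := fun M => ⟨σ M, hφσ M⟩
    exact hφ.comp hq
  · have : (1 - f) * f = 0 := by rw [sub_mul, one_mul, hf.eq, sub_self]
    calc f * b * (1 - f) * (f * b * (1 - f)) = f * b * ((1 - f) * f) * b * (1 - f) := by
          noncomm_ring
      _ = 0 := by rw [this]; simp
  · rwa [RingHom.comp_apply, hE]
  · simp only [RingHom.comp_apply, hE, h7]
  · simp only [RingHom.comp_apply, hE, h8]

/-! ### Orders, their quotients and base change -/

section Order

variable {F D ι : Type*} [Field F] [DivisionRing D] [Algebra F D] [Fintype ι]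

theorem Module.Basis.repr_mul_apply (b : Module.Basis ι F D) (x y : D) (k : ι) :
    b.repr (x * y) k = ∑ i, ∑ j, b.repr x i * b.repr y j * b.repr (b i * b j) k := by
  conv_lhs => rw [← b.sum_repr x, ← b.sum_repr y]
  simp only [Finset.sum_mul, Finset.mul_sum, smul_mul_assoc, mul_smul_comm, map_sum, map_smul,
    Finsupp.coe_finsetSum, Finset.sum_apply, Finsupp.smul_apply, smul_eq_mul]
  rw [Finset.sum_comm]
  exact Finset.sum_congr rfl fun i _ => Finset.sum_congr rfl fun j _ => by ring

/-- The structure constants of the algebra with respect to the basis `b`, and the coordinates of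
`1`, lie in the subring `O`. -/
structure IsIntegralBasis (b : Module.Basis ι F D) (O : Subring F) : Prop where
  one_mem : ∀ i, b.repr 1 i ∈ O
  mul_mem : ∀ i j k, b.repr (b i * b j) k ∈ O

variable {b : Module.Basis ι F D} {O R : Subring F}

omit [Fintype ι] in
theorem IsIntegralBasis.mono (h : IsIntegralBasis b R) (hRO : R ≤ O) :
    IsIntegralBasis b O :=
  ⟨fun i => hRO (h.one_mem i), fun i j k => hRO (h.mul_mem i j k)⟩

/-- The order of all elements of `D` whose coordinates lie in `O`. -/
noncomputable def IsIntegralBasis.order (h : IsIntegralBasis b O) : Subring D where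
  carrier := {d | ∀ i, b.repr d i ∈ O}
  one_mem' := h.one_mem
  zero_mem' i := by simp
  add_mem' hx hy i := by simpa using O.add_mem (hx i) (hy i)
  neg_mem' hx i := by simpa using O.neg_mem (hx i)
  mul_mem' hx hy k := by
    rw [b.repr_mul_apply]
    exact O.sum_mem fun i _ => O.sum_mem fun j _ =>
      O.mul_mem (O.mul_mem (hx i) (hy j)) (h.mul_mem i j k)

namespace IsIntegralBasis

theorem mem_order (h : IsIntegralBasis b O) {d : D} : d ∈ h.order ↔ ∀ i, b.repr d i ∈ O := Iff.rfl

theorem basis_mem_order (h : IsIntegralBasis b O) (i : ι) : b i ∈ h.order := by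
  classical
  intro j
  rw [b.repr_self, Finsupp.single_apply]
  split_ifs
  exacts [O.one_mem, O.zero_mem]

theorem smul_mem_order (h : IsIntegralBasis b O) {c : F} (hc : c ∈ O) {d : D} (hd : d ∈ h.order) :
    c • d ∈ h.order := fun i => by simpa using O.mul_mem hc (hd i)

/-- The coordinates of an element of the order, as elements of the base ring. -/
noncomputable def coord (h : IsIntegralBasis b O) (i : ι) : h.order →+ O where
  toFun d := ⟨b.repr d i, d.2 i⟩
  map_zero' := by ext; simp
  map_add' _ _ := by ext; simp

theorem coord_mul (h : IsIntegralBasis b O) (k : ι) (x y : h.order) :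
    h.coord k (x * y) = ∑ i, ∑ j, h.coord i x * h.coord j y *
      h.coord k (⟨b i, h.basis_mem_order i⟩ * ⟨b j, h.basis_mem_order j⟩) := by
  apply O.subtype_injective
  simp only [map_sum, map_mul]
  exact b.repr_mul_apply x.1 y.1 k

/-- The extension of an ideal of the base ring to the order. -/
noncomputable def orderIdeal (h : IsIntegralBasis b O) (I : Ideal O) : Ideal h.order where
  carrier := {d | ∀ i, h.coord i d ∈ I}
  zero_mem' i := by simp
  add_mem' hx hy i := by simpa using I.add_mem (hx i) (hy i)
  smul_mem' x y hy k := by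
    rw [smul_eq_mul, coord_mul]
    exact I.sum_mem fun i _ => I.sum_mem fun j _ =>
      I.mul_mem_right _ (I.mul_mem_left _ (hy j))

instance (h : IsIntegralBasis b O) (I : Ideal O) : (h.orderIdeal I).IsTwoSided where
  mul_mem_of_left {x} y hx k := by
    rw [coord_mul]
    exact I.sum_mem fun i _ => I.sum_mem fun j _ =>
      I.mul_mem_right _ (I.mul_mem_right _ (hx i))

theorem finite_quotient_orderIdeal (h : IsIntegralBasis b O) (I : Ideal O) [Finite (O ⧸ I)] :
    Finite (h.order ⧸ h.orderIdeal I) := by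
  let f : h.order →+ (ι → O ⧸ I) :=
    AddMonoidHom.mk' (fun d i => Ideal.Quotient.mk I (h.coord i d)) fun x y => by ext i; simp
  have hker : ∀ x y, f x = f y → Ideal.Quotient.mk (h.orderIdeal I) x =
      Ideal.Quotient.mk (h.orderIdeal I) y := by
    intro x y hxy
    rw [Ideal.Quotient.eq]
    intro i
    rw [map_sub, ← Ideal.Quotient.eq]
    exact congrFun hxy i
  have hf : Function.Injective fun z : h.order ⧸ h.orderIdeal I => f z.out := by
    intro z w hzw
    have := hker _ _ hzw
    rwa [show ∀ z : h.order ⧸ h.orderIdeal I, Ideal.Quotient.mk _ z.out = z from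
      fun z => Quotient.out_eq z, show ∀ z : h.order ⧸ h.orderIdeal I,
      Ideal.Quotient.mk _ z.out = z from fun z => Quotient.out_eq z] at this
  exact Finite.of_injective _ hf

theorem nontrivial_quotient_orderIdeal [Nonempty ι] (h : IsIntegralBasis b O) (I : Ideal O)
    (hI : I ≠ ⊤) : Nontrivial (h.order ⧸ h.orderIdeal I) := by
  rw [Ideal.Quotient.nontrivial_iff]
  intro htop
  obtain ⟨i⟩ := ‹Nonempty ι›
  have : (⟨b i, h.basis_mem_order i⟩ : h.order) ∈ h.orderIdeal I := htop ▸ trivial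
  refine hI ((Ideal.eq_top_iff_one I).2 ?_)
  convert this i
  ext
  simp [coord]

/-- Scalars from the base ring, as elements of the order. -/
noncomputable def scalar (h : IsIntegralBasis b O) : O →+* h.order :=
  ((algebraMap F D).comp O.subtype).codRestrict h.order fun c => by
    rw [RingHom.comp_apply, Algebra.algebraMap_eq_smul_one]
    exact h.smul_mem_order c.2 h.order.one_mem

theorem coe_scalar (h : IsIntegralBasis b O) (c : O) :
    (h.scalar c : D) = algebraMap F D c := rfl

theorem scalar_mem_orderIdeal (h : IsIntegralBasis b O) {I : Ideal O} {c : O} (hc : c ∈ I) :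
    h.scalar c ∈ h.orderIdeal I := by
  intro i
  have : h.coord i (h.scalar c) = c * ⟨b.repr 1 i, h.one_mem i⟩ := by
    ext
    simp [coord, coe_scalar, Algebra.algebraMap_eq_smul_one]
  rw [this]
  exact I.mul_mem_right _ hc

/-- The formula that defines `extendHom` already holds for `φ` on the smaller order;
multiplicativity is checked there, on basis elements. -/
theorem hom_eq_sum {Ω T : Type*} [Field Ω] [Ring T] [Algebra Ω T] (hR : IsIntegralBasis b R)
    (hRO : R ≤ O) (ρ : O →+* Ω) (φ : hR.order →+* T)
    (hφ : ∀ c : R, φ (hR.scalar c) = algebraMap Ω T (ρ (Subring.inclusion hRO c)))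
    (a : hR.order) :
    φ a = ∑ i, ρ ((hR.mono hRO).coord i ⟨a, fun i => hRO (a.2 i)⟩) •
      φ ⟨b i, hR.basis_mem_order i⟩ := by
  have : a = ∑ i, hR.scalar (hR.coord i a) * ⟨b i, hR.basis_mem_order i⟩ := by
    ext
    simp only [AddSubmonoidClass.coe_finsetSum, Subring.coe_mul, coe_scalar, ← Algebra.smul_def]
    exact (b.sum_repr _).symm
  conv_lhs => rw [this]
  simp only [map_sum, map_mul, hφ, ← Algebra.smul_def]
  rfl

/-- The base change of a ring homomorphism from the order over `R` to an algebra over a field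
`Ω`, along a homomorphism `ρ : O → Ω`, where `R ≤ O`. -/
noncomputable def extendHom {Ω T : Type*} [Field Ω] [Ring T] [Algebra Ω T] (hR : IsIntegralBasis b R)
    (hRO : R ≤ O) (ρ : O →+* Ω) (φ : hR.order →+* T)
    (hφ : ∀ c : R, φ (hR.scalar c) = algebraMap Ω T (ρ (Subring.inclusion hRO c))) :
    (hR.mono hRO).order →+* T :=
  let h := hR.mono hRO
  let β : ι → hR.order := fun i => ⟨b i, hR.basis_mem_order i⟩
  { toFun := fun a => ∑ i, ρ (h.coord i a) • φ (β i)
    map_zero' := by simp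
    map_add' := fun x y => by simp [add_smul, Finset.sum_add_distrib]
    map_one' := by rw [← map_one φ, hR.hom_eq_sum hRO ρ φ hφ 1]; rfl
    map_mul' := fun x y => by
      have h2 : ∀ i j, φ (β i) * φ (β j) =
          ∑ k, ρ (h.coord k (⟨b i, h.basis_mem_order i⟩ * ⟨b j, h.basis_mem_order j⟩)) •
            φ (β k) := by
        intro i j
        rw [← map_mul, hR.hom_eq_sum hRO ρ φ hφ]
        rfl
      simp only [fun k => h.coord_mul k x y, map_sum, map_mul, Finset.sum_mul, Finset.mul_sum, smul_mul_assoc,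
        mul_smul_comm, h2, Finset.smul_sum, smul_smul, Finset.sum_smul]
      rw [Finset.sum_comm]
      conv_rhs => rw [Finset.sum_comm]
      refine Finset.sum_congr rfl fun i _ => ?_
      rw [Finset.sum_comm]
      refine Finset.sum_congr rfl fun j _ => Finset.sum_congr rfl fun k _ => ?_
      ring_nf }

end IsIntegralBasis

end Order

namespace IsIntegralBasis

section ExtendHom

variable {F D ι : Type*} [Field F] [DivisionRing D] [Algebra F D] [Fintype ι]
  {b : Module.Basis ι F D} {O R : Subring F}
  {Ω T : Type*} [Field Ω] [Ring T] [Algebra Ω T] (hR : IsIntegralBasis b R)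
    (hRO : R ≤ O) (ρ : O →+* Ω) (φ : hR.order →+* T)
    (hφ : ∀ c : R, φ (hR.scalar c) = algebraMap Ω T (ρ (Subring.inclusion hRO c)))

theorem order_mono : hR.order ≤ (hR.mono hRO).order := fun _ ha i => hRO (ha i)

theorem extendHom_inclusion (a : hR.order) :
    hR.extendHom hRO ρ φ hφ (Subring.inclusion (hR.order_mono hRO) a) = φ a :=
  (hR.hom_eq_sum hRO ρ φ hφ a).symm

theorem extendHom_eq_zero {a : (hR.mono hRO).order}
    (ha : ∀ i, ρ ((hR.mono hRO).coord i a) = 0) : hR.extendHom hRO ρ φ hφ a = 0 := by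
  show ∑ i, ρ ((hR.mono hRO).coord i a) • φ ⟨b i, hR.basis_mem_order i⟩ = 0
  simp [ha]

end ExtendHom

/-! ### Orders over valuation rings -/

section Valuation

variable {F D ι : Type*} [Field F] [DivisionRing D] [Algebra F D] [Fintype ι]
  {b : Module.Basis ι F D} {V : ValuationSubring F} (h : IsIntegralBasis b V.toSubring)
include h

theorem mem_order_iff_valuation {d : D} : d ∈ h.order ↔ ∀ i, V.valuation (b.repr d i) ≤ 1 :=
  forall_congr' fun _ => (V.valuation_le_one_iff _).symm

omit h in
theorem exists_smul_mem_order {d : D} (hd : d ≠ 0) (h : IsIntegralBasis b V.toSubring) :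
    ∃ c : F, c ≠ 0 ∧ c • d ∈ h.order ∧ ∃ i, b.repr (c • d) i = 1 := by
  have : Nonempty ι := by
    by_contra hι
    rw [not_nonempty_iff] at hι
    exact hd (b.ext_elem fun i => hι.elim i)
  obtain ⟨i, -, hi⟩ := Finset.exists_max_image Finset.univ (fun i => V.valuation (b.repr d i))
    Finset.univ_nonempty
  have hi0 : b.repr d i ≠ 0 := by
    intro h0
    refine hd (b.ext_elem fun j => ?_)
    have := hi j (Finset.mem_univ j)
    simp only [h0, map_zero] at this
    simpa using this
  refine ⟨(b.repr d i)⁻¹, inv_ne_zero hi0, ?_, i, by simp [hi0]⟩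
  rw [h.mem_order_iff_valuation]
  intro j
  have hv : V.valuation (b.repr d i) ≠ 0 := by simpa using hi0
  simp only [map_smul, Finsupp.smul_apply, smul_eq_mul, map_mul, map_inv₀]
  rw [inv_mul_le_iff₀ (zero_lt_iff.2 hv), mul_one]
  exact hi j (Finset.mem_univ j)

theorem valuation_smul_lt_one {c : F} (hc : V.valuation c < 1) {d : D} (hd : d ∈ h.order) (i : ι) :
    V.valuation (b.repr (c • d) i) < 1 := by
  simp only [map_smul, Finsupp.smul_apply, smul_eq_mul, map_mul]
  exact mul_lt_one_of_lt_of_le hc (h.mem_order_iff_valuation.1 hd i)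

theorem one_ne_smul {c : F} (hc : V.valuation c < 1) {d : D} (hd : d ∈ h.order) : 1 ≠ c • d := by
  intro h1
  obtain ⟨e, -, he, i, hi⟩ := h.exists_smul_mem_order (one_ne_zero (α := D))
  have := h.valuation_smul_lt_one hc (h.order.mul_mem he hd) i
  rw [← mul_smul_comm, ← h1, mul_one, hi, map_one] at this
  exact lt_irrefl _ this

theorem one_sub_smul_ne_zero {c : F} (hc : V.valuation c < 1) {d : D} (hd : d ∈ h.order) :
    1 - c • d ≠ 0 := sub_ne_zero.2 (h.one_ne_smul hc hd)

/-- No completeness is available for a geometric series. Instead scale the inverse by `l` to an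
element `g` of the order with a coordinate 1. Then `g * (1 - c • d) = l`: `V.valuation l < 1` would
make that coordinate small, and `V.valuation l > 1` would make 1 a small multiple of an order
element. -/
theorem inv_one_sub_smul_mem {c : F} (hc : V.valuation c < 1) {d : D} (hd : d ∈ h.order) :
    (1 - c • d)⁻¹ ∈ h.order := by
  have hu := h.one_sub_smul_ne_zero hc hd
  obtain ⟨l, hl, hg, i, hi⟩ := h.exists_smul_mem_order (inv_ne_zero hu)
  set g := l • (1 - c • d)⁻¹ with hgdef
  have hinv : (1 - c • d)⁻¹ = l⁻¹ • g := by rw [hgdef, smul_smul, inv_mul_cancel₀ hl, one_smul]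
  have hgl : g - c • (g * d) = l • 1 := by
    rw [← mul_smul_comm, ← mul_one_sub, hgdef, smul_mul_assoc, inv_mul_cancel₀ hu]
  rcases le_total (V.valuation l) 1 with hle | hle
  · rcases hle.lt_or_eq with hlt | heq
    · exfalso
      have h1 := h.valuation_smul_lt_one hlt h.order.one_mem i
      have h2 := h.valuation_smul_lt_one hc (h.order.mul_mem hg hd) i
      have h3 : b.repr g i = b.repr (l • 1) i + b.repr (c • (g * d)) i := by
        rw [← hgl, map_sub, Finsupp.sub_apply, sub_add_cancel]
      rw [hi] at h3
      have := V.valuation.map_add_lt h1 h2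
      rw [← h3, map_one] at this
      exact lt_irrefl _ this
    · rw [hinv]
      refine h.smul_mem_order ?_ hg
      show l⁻¹ ∈ V
      rw [← V.valuation_le_one_iff, map_inv₀, heq, inv_one]
  · rcases hle.lt_or_eq with hlt | heq
    · exfalso
      have hl1 : V.valuation l⁻¹ < 1 := by
        rw [map_inv₀]
        exact inv_lt_one_of_one_lt₀ hlt
      refine h.one_ne_smul hl1 (d := g - c • (g * d)) ?_ ?_
      · refine h.order.sub_mem hg (h.smul_mem_order ?_ (h.order.mul_mem hg hd))
        exact (V.valuation_le_one_iff c).1 hc.le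
      · rw [hgl, smul_smul, inv_mul_cancel₀ hl, one_smul]
    · rw [hinv]
      refine h.smul_mem_order ?_ hg
      show l⁻¹ ∈ V
      rw [← V.valuation_le_one_iff, map_inv₀, ← heq, inv_one]

variable {Ω T : Type*} [Field Ω] [Ring T] [Algebra Ω T] (ψ : h.order →+* T)

/-- The iterated conjugates of `x` by `t + E`, where `E` is nilpotent modulo `t³`, are unbounded:
after scaling by a power of `t` they reduce to nonzero multiples of `E`. -/
theorem iterConj_notMem_order
    (hψ : ∀ a : h.order, (∀ i, V.valuation (b.repr (a : D) i) < 1) → ψ a = 0)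
    {x : Dˣ} {X X' E ε : h.order} (hX : (X : D) = x) (hX' : (X' : D) = (x⁻¹ : Dˣ))
    {t : F} (ht : V.valuation t < 1) (ht0 : t ≠ 0) (hE : (E : D) * E = t ^ 3 • (ε : D))
    (hE0 : ψ E ≠ 0) {α β : Ω} (hα : α ≠ 0) (hβ : β ≠ 0) (hEX : ψ E * ψ X * ψ E = α • ψ E)
    (hEX' : ψ E * ψ X' * ψ E = β • ψ E) :
    ∃ y : Dˣ, ∀ k ≥ 1, ((iterConj x y k : Dˣ) : D) ∉ h.order := by
  have htV : t ∈ V.toSubring := (V.valuation_le_one_iff t).1 ht.le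
  let τ : h.order := h.scalar ⟨t, htV⟩
  have hτ : (τ : D) = algebraMap F D t := rfl
  have hτ0 : ψ τ = 0 := by
    refine hψ _ fun i => ?_
    rw [hτ, Algebra.algebraMap_eq_smul_one]
    exact h.valuation_smul_lt_one ht h.order.one_mem i
  let U : h.order := ⟨_, h.inv_one_sub_smul_mem ht ε.2⟩
  have hu := h.one_sub_smul_ne_zero ht ε.2
  have hU : ψ U = 1 := by
    have h1 : (1 - τ * ε) * U = 1 := by
      ext
      show (1 - algebraMap F D t * (ε : D)) * (1 - t • (ε : D))⁻¹ = 1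
      rw [← Algebra.smul_def, mul_inv_cancel₀ hu]
    simpa [hτ0] using congrArg ψ h1
  have hcomm : ∀ d : D, Commute (algebraMap F D t) d := fun d => Algebra.commutes t d
  have htD : algebraMap F D t ≠ 0 := by simpa using ht0
  have hprod : (algebraMap F D t + (E : D)) * (algebraMap F D t - E) =
      algebraMap F D t ^ 2 * (1 - t • (ε : D)) := by
    have : (algebraMap F D t + (E : D)) * (algebraMap F D t - E) =
        algebraMap F D t ^ 2 - (E : D) * E := by
      rw [add_mul, mul_sub, mul_sub, (hcomm E).eq]
      noncomm_ring
    rw [this, hE, mul_sub, mul_one, Algebra.smul_def, Algebra.smul_def, ← mul_assoc, map_pow]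
    noncomm_ring
  have hprod0 : (algebraMap F D t + (E : D)) * (algebraMap F D t - E) ≠ 0 := by
    rw [hprod]
    exact mul_ne_zero (pow_ne_zero 2 htD) hu
  let y : Dˣ := Units.mk0 _ (left_ne_zero_of_mul hprod0)
  have hy : (y : D) = algebraMap F D t + E := rfl
  have hyinv : algebraMap F D t ^ 2 * ((y⁻¹ : Dˣ) : D) =
      (algebraMap F D t - E) * (1 - t • (ε : D))⁻¹ := by
    apply mul_left_cancel₀ y.ne_zero
    rw [← mul_assoc, ← ((hcomm (y : D)).pow_left 2).eq, mul_assoc, Units.mul_inv, ← mul_assoc, hy,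
      hprod, mul_assoc, mul_inv_cancel₀ hu]
  refine ⟨y, ?_⟩
  -- The inverse is tracked too, since the next conjugate uses both; its scaling exponent is then `2
  -- * s`.
  have main : ∀ k, ∃ s ≥ 1, ∃ (P Q : h.order) (p q : Ω), p ≠ 0 ∧ q ≠ 0 ∧
      (P : D) = algebraMap F D t ^ s * (iterConj x y (k + 1) : Dˣ) ∧
      (Q : D) = algebraMap F D t ^ s * ((iterConj x y (k + 1))⁻¹ : Dˣ) ∧
      ψ P = p • ψ E ∧ ψ Q = q • ψ E := by
    intro k
    induction k with
    | zero =>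
      refine ⟨2, by norm_num, (τ + E) * X * ((τ - E) * U), (τ + E) * X' * ((τ - E) * U), -α, -β,
        neg_ne_zero.2 hα, neg_ne_zero.2 hβ, ?_, ?_, ?_, ?_⟩
      · simp only [iterConj, Subring.coe_mul, Subring.coe_add, AddSubgroupClass.coe_sub, hX,
          Units.val_mul, U, hτ]
        rw [← hyinv, ← hy, ← mul_assoc, ← mul_assoc, ((hcomm _).pow_left 2).eq]
      · simp only [iterConj, Subring.coe_mul, Subring.coe_add, AddSubgroupClass.coe_sub, hX',
          Units.val_mul, U, hτ, mul_inv_rev, inv_inv]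
        rw [← hyinv, ← hy, ← mul_assoc, ← ((hcomm _).pow_left 2).eq, mul_assoc, mul_assoc]
      · simp [hτ0, hU, hEX]
      · simp [hτ0, hU, hEX']
    | succ k ih =>
      obtain ⟨s, hs, P, Q, p, q, hp, hq, hP, hQ, hψP, hψQ⟩ := ih
      refine ⟨2 * s, by omega, P * X * Q, P * X' * Q, p * q * α, p * q * β,
        mul_ne_zero (mul_ne_zero hp hq) hα, mul_ne_zero (mul_ne_zero hp hq) hβ, ?_, ?_, ?_, ?_⟩
      · rw [iterConj]
        generalize iterConj x y (k + 1) = f at *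
        simp only [Subring.coe_mul, hP, hQ, hX, Units.val_mul]
        rw [two_mul, pow_add]
        simp only [mul_assoc]
        rw [((hcomm (x : D)).pow_left s).symm.left_comm,
          ((hcomm (f : D)).pow_left s).symm.left_comm]
      · rw [iterConj]
        generalize iterConj x y (k + 1) = f at *
        simp only [Subring.coe_mul, hP, hQ, hX', Units.val_mul, mul_inv_rev, inv_inv]
        rw [two_mul, pow_add]
        simp only [mul_assoc]
        rw [((hcomm ((x⁻¹ : Dˣ) : D)).pow_left s).symm.left_comm,
          ((hcomm (f : D)).pow_left s).symm.left_comm]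
      · simp only [map_mul, hψP, hψQ, smul_mul_assoc, mul_smul_comm, hEX, smul_smul]
        congr 1; ring
      · simp only [map_mul, hψP, hψQ, smul_mul_assoc, mul_smul_comm, hEX', smul_smul]
        congr 1; ring
  intro k hk hmem
  obtain ⟨k, rfl⟩ : ∃ j, k = j + 1 := ⟨k - 1, by omega⟩
  obtain ⟨s, hs, P, -, p, -, hp, -, hP, -, hψP, -⟩ := main k
  have : P = τ ^ s * ⟨_, hmem⟩ := by
    ext
    simp [hP, hτ]
  rw [this, map_mul, map_pow, hτ0, zero_pow (by omega), zero_mul] at hψP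
  exact smul_ne_zero hp hE0 hψP.symm

end Valuation

end IsIntegralBasis

/-! ### Dominating valuation rings and reduction maps -/

theorem ValuationSubring.exists_mem_forall_pow_valuation_le {F : Type*} [Field F] {R : Subring F}
    {m : Ideal R} (hm : m.FG) (V : ValuationSubring F) (hRV : R ≤ V.toSubring) :
    ∃ t ∈ m, ∀ n, ∀ x ∈ m ^ n, V.valuation (x : F) ≤ V.valuation (t : F) ^ n := by
  obtain ⟨s, rfl⟩ := hm
  have hR1 : ∀ x : R, V.valuation (x : F) ≤ 1 := fun x => (V.valuation_le_one_iff _).2 (hRV x.2)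
  let B : V.ValueGroup → Ideal R := fun γ =>
    { carrier := {x | V.valuation (x : F) ≤ γ}
      zero_mem' := by simp
      add_mem' := fun {x y} hx hy => by
        exact (V.valuation.map_add x.1 y.1).trans (max_le hx hy)
      smul_mem' := fun c x hx => by
        show V.valuation ((c : F) * x) ≤ γ
        rw [map_mul]
        exact mul_le_of_le_one_of_le (hR1 c) hx }
  obtain ⟨t, ht, hts⟩ : ∃ t ∈ Ideal.span (s : Set R), ∀ x ∈ s,
      V.valuation (x : F) ≤ V.valuation (t : F) := by
    rcases s.eq_empty_or_nonempty with rfl | hs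
    · exact ⟨0, Ideal.zero_mem _, by simp⟩
    · obtain ⟨t, ht, hmax⟩ := Finset.exists_max_image s (fun x => V.valuation (x : F)) hs
      exact ⟨t, Ideal.subset_span ht, hmax⟩
  refine ⟨t, ht, fun n => ?_⟩
  have hle : Ideal.span (s : Set R) ≤ B (V.valuation (t : F)) := Ideal.span_le.2 hts
  suffices Ideal.span (s : Set R) ^ n ≤ B (V.valuation (t : F) ^ n) from fun x hx => this hx
  induction n with
  | zero =>
    intro x _
    show V.valuation (x : F) ≤ V.valuation (t : F) ^ 0
    rw [pow_zero]
    exact hR1 x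
  | succ n ih =>
    rw [pow_succ, pow_succ, Ideal.mul_le]
    intro x hx y hy
    show V.valuation ((x : F) * y) ≤ _
    rw [map_mul]
    exact mul_le_mul' (ih hx) (hle hy)

theorem exists_isIntegralBasis_subset_order {F D ι : Type*} [Field F] [DivisionRing D]
    [Algebra F D] [Fintype ι] (b : Module.Basis ι F D) {G : Set D} (hG : G.Finite) :
    ∃ R : Subring F, Algebra.FiniteType ℤ R ∧ ∃ h : IsIntegralBasis b R, G ⊆ h.order := by
  let s : Set F := (⋃ d ∈ G, Set.range (b.repr d)) ∪ Set.range (b.repr 1) ∪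
    Set.range fun p : ι × ι × ι => b.repr (b p.1 * b p.2.1) p.2.2
  have hs : s.Finite := ((hG.biUnion fun d _ => Set.finite_range _).union
    (Set.finite_range _)).union (Set.finite_range _)
  have hsub : s ⊆ Subring.closure s := Subring.subset_closure
  refine ⟨Subring.closure s, ?_, ⟨fun i => hsub (.inl (.inr ⟨i, rfl⟩)),
    fun i j k => hsub (.inr ⟨(i, j, k), rfl⟩)⟩, fun d hd i =>
    hsub (.inl (.inl (Set.mem_biUnion hd ⟨i, rfl⟩)))⟩
  have hft : Algebra.FiniteType ℤ (Algebra.adjoin ℤ s) := Algebra.FiniteType.adjoin_of_finite hs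
  have heq := Algebra.adjoin_int s
  rw [heq] at hft
  exact hft

/-- By surjectivity, central elements map to matrices commuting with all matrix units. -/
theorem Matrix.exists_scalar_hom {R A K : Type*} [CommRing R] [Ring A] [Field K] {r : ℕ}
    (i₀ : Fin r) (f : R →+* A) (hf : ∀ c a, Commute (f c) a)
    (φ : A →+* Matrix (Fin r) (Fin r) K) (hφ : Function.Surjective φ) :
    ∃ θ : R →+* K, ∀ c, φ (f c) = algebraMap K (Matrix (Fin r) (Fin r) K) (θ c) := by
  have h : ∀ c, ∃ k, φ (f c) = algebraMap K (Matrix (Fin r) (Fin r) K) k := by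
    intro c
    obtain ⟨k, hk⟩ := Matrix.mem_range_scalar_of_commute_single (M := φ (f c)) fun i j _ => by
      obtain ⟨a, ha⟩ := hφ (Matrix.single i j 1)
      rw [← ha]
      exact ((hf c a).map φ).symm
    exact ⟨k, hk.symm⟩
  choose θ hθ using h
  have : Nonempty (Fin r) := ⟨i₀⟩
  have hinj : Function.Injective (algebraMap K (Matrix (Fin r) (Fin r) K)) :=
    (algebraMap K (Matrix (Fin r) (Fin r) K)).injective
  exact ⟨{ toFun := θ
           map_one' := hinj (by rw [← hθ]; simp)
           map_zero' := hinj (by rw [← hθ]; simp)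
           map_mul' := fun x y => hinj (by rw [← hθ]; simp [hθ])
           map_add' := fun x y => hinj (by rw [← hθ]; simp [hθ]) }, hθ⟩

theorem exists_hom_comp_eq {R K L : Type*} [CommRing R] [Field K] [Finite K] [Field L]
    (m : Ideal R) [hm : m.IsMaximal] (θ : R →+* K) (hθ : ∀ c ∈ m, θ c = 0) (ρ : R →+* L)
    (hρ : ∀ c ∈ m, ρ c = 0) [IsAlgClosed L] : ∃ τ : K →+* L, τ.comp θ = ρ := by
  let := Ideal.Quotient.field m
  let θ' : R ⧸ m →+* K := Ideal.Quotient.lift m θ hθ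
  let ρ' : R ⧸ m →+* L := Ideal.Quotient.lift m ρ hρ
  algebraize [θ', ρ']
  have : Module.Finite (R ⧸ m) K := Module.Finite.of_finite
  refine ⟨(IsAlgClosed.lift : K →ₐ[R ⧸ m] L).toRingHom, RingHom.ext fun c => ?_⟩
  exact (IsAlgClosed.lift : K →ₐ[R ⧸ m] L).commutes (Ideal.Quotient.mk m c)

universe u in
theorem ValuationSubring.exists_hom_isAlgClosed {F : Type u} [Field F] (V : ValuationSubring F) :
    ∃ (Ω : Type u) (_ : Field Ω) (_ : IsAlgClosed Ω) (ρ : V.toSubring →+* Ω),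
      ∀ c : V.toSubring, ρ c = 0 ↔ V.valuation (c : F) < 1 := by
  refine ⟨AlgebraicClosure (IsLocalRing.ResidueField V), inferInstance, inferInstance,
    (algebraMap (IsLocalRing.ResidueField V) _).comp (IsLocalRing.residue V), fun c => ?_⟩
  have h1 : algebraMap (IsLocalRing.ResidueField V)
      (AlgebraicClosure (IsLocalRing.ResidueField V)) (IsLocalRing.residue V c) = 0 ↔
      IsLocalRing.residue V c = 0 := by simp
  exact (h1.trans (IsLocalRing.residue_eq_zero_iff _)).trans
    (V.valuation_lt_one_iff (c : V))

/-- In a noncommutative order over a finitely generated ring, conjugating `x` repeatedly by a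
suitable element leaves the order for good. -/
theorem IsIntegralBasis.exists_iterConj_notMem_order {F D ι : Type*} [Field F] [DivisionRing D]
    [Algebra F D] [Fintype ι] {b : Module.Basis ι F D} {R : Subring F} [Algebra.FiniteType ℤ R]
    (h : IsIntegralBasis b R) {x : Dˣ} {a : D} (hx : (x : D) ∈ h.order)
    (hx' : ((x⁻¹ : Dˣ) : D) ∈ h.order) (ha : a ∈ h.order) (hxa : x * a - a * x ≠ 0)
    (hc : (x * a - a * x)⁻¹ ∈ h.order) :
    ∃ y : Dˣ, ∀ k ≥ 1, ((iterConj x y k : Dˣ) : D) ∉ h.order := by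
  have : Nonempty ι := by
    by_contra hι
    rw [not_nonempty_iff] at hι
    exact hxa (b.ext_elem fun i => hι.elim i)
  obtain ⟨m, hm⟩ := Ideal.exists_maximal R
  have hfin : Finite (R ⧸ m ^ 3) := finite_quotient_pow_of_finiteType_int m 3
  have hm3 : m ^ 3 ≠ ⊤ := fun h => hm.ne_top (top_le_iff.1 (h ▸ Ideal.pow_le_self (by norm_num)))
  have : Finite (h.order ⧸ h.orderIdeal (m ^ 3)) := h.finite_quotient_orderIdeal _
  have : Nontrivial (h.order ⧸ h.orderIdeal (m ^ 3)) := h.nontrivial_quotient_orderIdeal _ hm3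
  let q := Ideal.Quotient.mk (h.orderIdeal (m ^ 3))
  have hq : Function.Surjective q := Ideal.Quotient.mk_surjective
  let X : h.order := ⟨x, hx⟩
  let X' : h.order := ⟨_, hx'⟩
  let A : h.order := ⟨a, ha⟩
  have hXX' : X * X' = 1 := Subtype.ext (x.mul_inv)
  have hX'X : X' * X = 1 := Subtype.ext (x.inv_mul)
  have hcu : IsUnit (X * A - A * X) :=
    ⟨⟨X * A - A * X, ⟨_, hc⟩, Subtype.ext (mul_inv_cancel₀ hxa),
      Subtype.ext (inv_mul_cancel₀ hxa)⟩, rfl⟩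
  obtain ⟨K, _, _, r, φ, E', α, β, hφ, hEE, hE0, hα, hβ, hEX, hEX'⟩ :=
    exists_sq_zero_of_isUnit_commutator (x := q X) (x' := q X') (a := q A)
      (by rw [← map_mul, hXX', map_one]) (by rw [← map_mul, hX'X, map_one])
      (by simpa only [map_sub, map_mul] using hcu.map q)
  obtain ⟨E, rfl⟩ := hq E'
  rw [← map_mul, Ideal.Quotient.eq_zero_iff_mem] at hEE
  obtain ⟨i₀⟩ : Nonempty (Fin r) := by
    by_contra hr
    rw [not_nonempty_iff] at hr
    exact hE0 (Matrix.ext fun i => hr.elim i)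
  obtain ⟨θ, hθ⟩ := Matrix.exists_scalar_hom i₀ h.scalar
    (fun c d => Subtype.ext (Algebra.commutes (c : F) (d : D))) (φ.comp q) (hφ.comp hq)
  have hθm : ∀ c ∈ m, θ c = 0 := by
    intro c hcm
    have h1 : q (h.scalar (c ^ 3)) = 0 :=
      Ideal.Quotient.eq_zero_iff_mem.2 (h.scalar_mem_orderIdeal (Ideal.pow_mem_pow hcm 3))
    have h2 := hθ (c ^ 3)
    rw [RingHom.comp_apply, h1, map_zero, map_pow, map_pow] at h2
    have h3 := congrFun (congrFun h2.symm i₀) i₀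
    rw [← map_pow, Matrix.algebraMap_matrix_apply] at h3
    simpa using h3
  obtain ⟨V, hRV, hV⟩ := Ideal.image_subset_nonunits_valuationSubring m hm.ne_top
  have hmV : ∀ c ∈ m, V.valuation (c : F) < 1 := fun c hc =>
    (V.mem_nonunits_iff).1 (hV ⟨c, hc, rfl⟩)
  obtain ⟨Ω, _, _, ρ, hρ⟩ := V.exists_hom_isAlgClosed
  obtain ⟨τ, hτ⟩ := exists_hom_comp_eq m θ hθm (ρ.comp (Subring.inclusion hRV))
    fun c hc => (hρ _).2 (hmV c hc)
  let φΩ : h.order →+* Matrix (Fin r) (Fin r) Ω := τ.mapMatrix.comp (φ.comp q)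
  have hφΩ : ∀ c : R, φΩ (h.scalar c) =
      algebraMap Ω (Matrix (Fin r) (Fin r) Ω) (ρ (Subring.inclusion hRV c)) := by
    intro c
    rw [RingHom.comp_apply, hθ, ← RingHom.comp_apply ρ, ← hτ]
    ext i j
    simp [Matrix.algebraMap_matrix_apply, apply_ite τ]
  have hsmul : ∀ (k : K) (M : Matrix (Fin r) (Fin r) K),
      τ.mapMatrix (k • M) = τ k • τ.mapMatrix M := by
    intro k M
    ext i j
    simp
  have : IsNoetherianRing R := Algebra.FiniteType.isNoetherianRing ℤ R
  obtain ⟨t, htm, ht⟩ := V.exists_mem_forall_pow_valuation_le (IsNoetherian.noetherian m) hRV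
  have hEv : ∀ i, V.valuation (b.repr (E * E : D) i) ≤ V.valuation (t : F) ^ 3 :=
    fun i => ht 3 _ (hEE i)
  -- If `t = 0` then `E * E = 0`, impossible for nonzero `E` in a division ring.
  have ht0 : (t : F) ≠ 0 := by
    intro h0
    have hEE0 : (E : D) * E = 0 := b.ext_elem fun i => by
      simpa [h0] using hEv i
    have : E = 0 := Subtype.ext (mul_self_eq_zero.1 hEE0)
    exact hE0 (by rw [this, map_zero, map_zero])
  have hε : ((t : F) ^ 3)⁻¹ • ((E : D) * E) ∈ (h.mono hRV).order := by
    rw [mem_order_iff_valuation]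
    intro i
    have hv : V.valuation (t : F) ≠ 0 := by simpa using ht0
    rw [map_smul, Finsupp.smul_apply, smul_eq_mul, map_mul, map_inv₀, map_pow,
      inv_mul_le_iff₀ (zero_lt_iff.2 (pow_ne_zero 3 hv)), mul_one]
    exact hEv i
  let incl := Subring.inclusion (h.order_mono hRV)
  have hψ := h.extendHom_inclusion hRV ρ φΩ hφΩ
  obtain ⟨y, hy⟩ := (h.mono hRV).iterConj_notMem_order (h.extendHom hRV ρ φΩ hφΩ)
    (fun a ha => h.extendHom_eq_zero hRV ρ φΩ hφΩ fun i => (hρ _).2 (ha i))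
    (x := x) (X := incl X) (X' := incl X') (E := incl E) (ε := ⟨_, hε⟩) rfl rfl (hmV t htm) ht0
    (by rw [smul_smul, mul_inv_cancel₀ (pow_ne_zero 3 ht0), one_smul]; rfl)
    (α := τ α) (β := τ β)
    (by
      rw [hψ]
      intro h0
      refine hE0 (Matrix.ext fun i j => τ.injective ?_)
      simpa [φΩ] using congrFun (congrFun h0 i) j)
    (by simpa using hα) (by simpa using hβ)
    (by
      rw [hψ, hψ]
      show τ.mapMatrix _ * τ.mapMatrix _ * τ.mapMatrix _ = _
      rw [← map_mul, ← map_mul]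
      exact (congrArg τ.mapMatrix hEX).trans (hsmul _ _))
    (by
      rw [hψ, hψ]
      show τ.mapMatrix _ * τ.mapMatrix _ * τ.mapMatrix _ = _
      rw [← map_mul, ← map_mul]
      exact (congrArg τ.mapMatrix hEX').trans (hsmul _ _))
  exact ⟨y, fun k hk hmem => hy k hk (h.order_mono hRV hmem)⟩

/-! ### The finite-dimensional case and the reduction to it -/

theorem Subgroup.IsSubnormal.mul_comm_of_fg (F : Type*) {D : Type*} [Field F] [DivisionRing D]
    [Algebra F D] [FiniteDimensional F D] {N : Subgroup Dˣ} (hfg : N.FG) (hsub : N.IsSubnormal)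
    {x : Dˣ} (hx : x ∈ N) (a : D) : x * a = a * x := by
  by_contra hxa
  rw [← sub_eq_zero] at hxa
  obtain ⟨S, rfl⟩ := hfg
  -- Including the inverse of the commutator keeps it a unit in every quotient of the order.
  let G : Set D := (((↑) : Dˣ → D) '' S ∪ (fun g : Dˣ => ((g⁻¹ : Dˣ) : D)) '' S) ∪
    {(x : D), ((x⁻¹ : Dˣ) : D), a, (x * a - a * x)⁻¹}
  have hG : G.Finite := ((S.finite_toSet.image _).union (S.finite_toSet.image _)).union
    (Set.toFinite _)
  obtain ⟨R, hR, h, hGR⟩ := exists_isIntegralBasis_subset_order (Module.finBasis F D) hG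
  have hN : ∀ g ∈ Subgroup.closure (S : Set Dˣ),
      (g : D) ∈ h.order ∧ ((g⁻¹ : Dˣ) : D) ∈ h.order := by
    intro g hg
    induction hg using Subgroup.closure_induction with
    | mem g hg => exact ⟨hGR (.inl (.inl ⟨g, hg, rfl⟩)), hGR (.inl (.inr ⟨g, hg, rfl⟩))⟩
    | one => simp [h.order.one_mem]
    | mul g g' _ _ ih ih' =>
      rw [mul_inv_rev, Units.val_mul, Units.val_mul]
      exact ⟨h.order.mul_mem ih.1 ih'.1, h.order.mul_mem ih'.2 ih.2⟩
    | inv g _ ih => rwa [inv_inv, and_comm]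
  obtain ⟨y, hy⟩ := h.exists_iterConj_notMem_order (x := x) (a := a) (hGR (.inr (by simp)))
    (hGR (.inr (by simp))) (hGR (.inr (by simp))) hxa (hGR (.inr (by simp)))
  obtain ⟨n, hn⟩ := hsub.exists_iterConj_mem
  exact hy (n + 1) (by omega) (hN _ (hn x hx y (n + 1) (by omega))).1

theorem theorem4p1 {D : Type*} [DivisionRing D] (hD : IsWeaklyLocallyFinite D)
    (N : Subgroup Dˣ) (hfg : N.FG) (hsub : N.IsSubnormal) :
    ∀ x ∈ N, (x : D) ∈ Subring.center D := by
  intro x hx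
  rw [Subring.mem_center_iff]
  intro d
  obtain ⟨S, rfl⟩ := hfg
  let T : Set D := insert d (((↑) : Dˣ → D) '' S)
  let L := Subfield.closure T
  have hL : IsCentrallyFinite L := hD T ((S.finite_toSet.image _).insert d)
  have hdL : d ∈ L := Subfield.subset_closure (Set.mem_insert _ _)
  let f : Lˣ →* Dˣ := Units.map (L.subtype : L →* D)
  have hf : Function.Injective f := Units.map_injective L.subtype_injective
  have hrange : Subgroup.closure (S : Set Dˣ) ≤ f.range := by
    rw [Subgroup.closure_le]
    intro g hg
    have hgL : (g : D) ∈ L := Subfield.subset_closure (Set.mem_insert_of_mem _ ⟨g, hg, rfl⟩)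
    exact ⟨Units.mk0 ⟨g, hgL⟩ fun h0 => g.ne_zero (congrArg Subtype.val h0), Units.ext rfl⟩
  let N' := (Subgroup.closure (S : Set Dˣ)).comap f
  have hN' : N'.FG := by
    rw [Subgroup.fg_iff_submonoid_fg]
    refine Submonoid.FG.map_injective f hf ?_
    rw [show N'.toSubmonoid.map f = (Subgroup.closure (S : Set Dˣ)).toSubmonoid from
      congrArg Subgroup.toSubmonoid (Subgroup.map_comap_eq_self hrange)]
    exact (Subgroup.fg_iff_submonoid_fg _).1 ⟨S, rfl⟩
  obtain ⟨x', rfl⟩ := hrange hx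
  have : FiniteDimensional (Subring.center L) L := hL
  have := Subgroup.IsSubnormal.mul_comm_of_fg (Subring.center L) hN' (hsub.comap f)
    (x := x') hx ⟨d, hdL⟩
  exact (congrArg Subtype.val this).symm
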